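/- Let $n\ge 0$ and let $S_n$ be the real vector space of real symmetric $n\times n$ matrices; $\dim S_n=n(n+1)/2$. Say that a nonempty set $S\subseteq S_n$ has dimension $d$ if it is an embedded $C^\infty$ submanifold of $S_n$ of dimension $d$, and then that its codimension is $\dim S_n-d$. For positive integers $k_1,\dots,k_I$ with $k_1+\cdots+k_I=n$ let $M(k_1,\dots,k_I)\subseteq S_n$ be the set of the matrices having exactly $I$ distinct eigenvalues, with multiplicities $k_1,\dots,k_I$ (in any order). 1. If $\Lambda$ is a real diagonal $n\times n$ matrix having exactly $I$ distinct eigenvalues, with multiplicities $k_1,\dots,k_I$, then the set $\{O\Lambda O^T : O \text{ real orthogonal}\}$ has dimension $$\frac{n(n-1)}2-\sum_{i=1}^I\frac{k_i(k_i-1)}2 .$$ 2. The set $M(k_1,\dots,k_I)$ has dimension $$\frac{n(n-1)}2+I-\sum_{i=1}^I\frac{k_i(k_i-1)}2 .$$ 3. The codimension of $M(k_1,\dots,k_I)$ in $S_n$ is $$c=\frac{n(n+1)}2-\left[\frac{n(n-1)}2+I-\sum_{i=1}^I\frac{k_i(k_i-1)}2\right]=\frac12\sum_{i=1}^I(k_i+2)(k_i-1),$$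 and this is the number of conditions that the elements of a matrix must satisfy to lie in $M(k_1,\dots,k_I)$: each point of $M(k_1,\dots,k_I)$ has an open neighbourhood $U\subseteq S_n$ and a $C^\infty$ map $f:U\to\mathbb R^c$ with surjective derivative at every point of $U$ such that $M(k_1,\dots,k_I)\cap U=f^{-1}(0)$. 4. Let $1\le k\le n$. The set $M(k,1,\dots,1)$ of the matrices with one $k$-fold eigenvalue and all others simple has codimension $(k+2)(k-1)/2$, which is also the number of conditions in the sense of 3. This is the least codimension for a $k$-fold eigenvalue: if $k_1=k$, then the codimension of $M(k_1,\dots,k_I)$ is at least $(k+2)(k-1)/2$, with equality if and only if $k_2=\cdots=k_I=1$. In particular, for $n\ge 2$ and $k=2$ the codimension and the number of conditions are $2$ (von Neumann–Wigner). -/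

import Mathlib

open scoped ContDiff Matrix.Norms.Elementwise

namespace MultEig

section Dimension

variable {E : Type*} [NormedAddCommGroup E] [NormedSpace ℝ E]

/-- `S` is a nonempty embedded `C^∞` submanifold of `E`, of dimension `d`: around each point of `S`
there is a `C^∞` diffeomorphism `φ` between open subsets of `E` which takes `S` to a linear
subspace of dimension `d`. -/
def HasDim (S : Set E) (d : ℕ) : Prop :=
  S.Nonempty ∧ ∀ p ∈ S, ∃ (φ : OpenPartialHomeomorph E E) (F : Submodule ℝ E),
    p ∈ φ.source ∧ ContDiffOn ℝ ∞ φ φ.source ∧ ContDiffOn ℝ ∞ φ.symm φ.target ∧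
      Module.finrank ℝ F = d ∧ ∀ x ∈ φ.source, (x ∈ S ↔ φ x ∈ F)

/-- The codimension of `S` in `E` is `c`: the dimension of `E` minus that of `S` is `c`. -/
def HasCodim (S : Set E) (c : ℕ) : Prop :=
  ∃ d : ℕ, HasDim S d ∧ d + c = Module.finrank ℝ E

/-- Near each of its points, `S` is described by `c` independent `C^∞` scalar conditions. -/
def IsGivenByConditions (S : Set E) (c : ℕ) : Prop :=
  ∀ p ∈ S, ∃ (U : Set E) (f : E → Fin c → ℝ), IsOpen U ∧ p ∈ U ∧ ContDiffOn ℝ ∞ f U ∧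
    (∀ x ∈ U, Function.Surjective (fderiv ℝ f x)) ∧ ∀ x ∈ U, (x ∈ S ↔ f x = 0)

end Dimension

/-- The space of real symmetric matrices of order `n`. -/
def symMat (n : ℕ) : Submodule ℝ (Matrix (Fin n) (Fin n) ℝ) where
  carrier := {A | A.IsSymm}
  add_mem' hA hB := Matrix.IsSymm.add hA hB
  zero_mem' := Matrix.isSymm_zero
  smul_mem' c _ hA := Matrix.IsSymm.smul hA c

/-- The real matrix `A` has exactly `I` distinct eigenvalues, all real, with multiplicities
`k 0, …, k (I - 1)` in some order. (It is meant for positive `k i`.) -/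
def HasMult {n I : ℕ} (A : Matrix (Fin n) (Fin n) ℝ) (k : Fin I → ℕ) : Prop :=
  ∃ ev : Fin I → ℝ, Function.Injective ev ∧
    A.charpoly = ∏ i, (Polynomial.X - Polynomial.C (ev i)) ^ k i

/-- The set of real symmetric matrices of order `n` with eigenvalue multiplicities `k`. -/
def multSet (n : ℕ) {I : ℕ} (k : Fin I → ℕ) : Set (symMat n) :=
  {A | HasMult (A : Matrix (Fin n) (Fin n) ℝ) k}

/-- The set of real symmetric matrices `O Λ Oᵀ` with `O` orthogonal, where `Λ` is the diagonal
matrix with diagonal entries `a`. -/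
def orthOrbit {n : ℕ} (a : Fin n → ℝ) : Set (symMat n) :=
  {A | ∃ O ∈ Matrix.orthogonalGroup (Fin n) ℝ,
    (A : Matrix (Fin n) (Fin n) ℝ) = O * Matrix.diagonal a * O.transpose}

end MultEig

namespace MultEig

/-! ### Charts from parametrizations, and conditions from charts. -/

section Charts

open Filter Topology

variable {E : Type*} [NormedAddCommGroup E] [NormedSpace ℝ E]

/-! Fix a point `V * diagonal a * Vᵀ`, with `V` orthogonal, and call the level sets of `a` blocks.
Near it the symmetric matrices are written as `R * (diagonal a + blockPart a S) * Rᵀ`, where `R = V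
* cayley K` and the skew matrix `K` depends linearly on the off-block entries of `S`. The derivative
at `S = 0` is `V * S * Vᵀ` (`hasFDerivAt_param`), so the inverse function theorem makes this a local
diffeomorphism.

The eigenvalues depend only on the block factor, and for small `S` both sets become linear in `S`:
the orbit is where the block part vanishes (`param_mem_orthOrbit_iff`), the multiplicity set where
it is scalar on each block (`param_mem_multSet_iff`). The reason is that the eigenvalues of the
block factor stay in disjoint clusters around the distinct values of `a`. If there are only as many
eigenvalues as clusters, each cluster is a single eigenvalue, and a symmetric block with one
eigenvalue is scalar.

Dimensions are then counts: one parameter per pair `i < j` in different blocks, plus one per block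
for the multiplicity set. The codimension is a sum of terms `(k + 2) * (k - 1) / 2`, each
nonnegative and zero only for `k = 1`. -/

/-- A local analytic parametrization `Ψ` with invertible derivative, which takes the subspace `F`
to `S`, yields a chart of `S`. -/
theorem exists_chart_of_param [CompleteSpace E] {S : Set E} {F : Submodule ℝ E} {Ψ : E → E} {x₀ : E}
    {e : E ≃L[ℝ] E} (hΨ : ContDiffAt ℝ ω Ψ x₀) (hd : HasFDerivAt Ψ (e : E →L[ℝ] E) x₀)
    (hS : ∀ᶠ x in 𝓝 x₀, (Ψ x ∈ S ↔ x ∈ F)) :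
    ∃ φ : OpenPartialHomeomorph E E,
      Ψ x₀ ∈ φ.source ∧ ContDiffOn ℝ ∞ φ φ.source ∧ ContDiffOn ℝ ∞ φ.symm φ.target ∧
        ∀ x ∈ φ.source, (x ∈ S ↔ φ x ∈ F) := by
  have hω : (ω : WithTop ℕ∞) ≠ 0 := by simp
  set ψ := hΨ.toOpenPartialHomeomorph Ψ hd hω with hψ
  have hcoe : ∀ x, ψ x = Ψ x := fun x => rfl
  have hmem : x₀ ∈ ψ.source := hΨ.mem_toOpenPartialHomeomorph_source hd hω
  have hsymm : ContDiffAt ℝ ω ψ.symm (ψ x₀) := by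
    apply ψ.contDiffAt_symm (ψ.map_source hmem) (f₀' := e)
    · rw [ψ.left_inv hmem]; exact hd
    · rw [ψ.left_inv hmem]; exact hΨ
  -- Being `C^ω` at a point spreads to a neighbourhood; for `C^∞` at a point the neighbourhoods may
  -- shrink with the order. Hence `ω` in the hypothesis.
  have h1 : ∀ᶠ x in 𝓝 x₀, ContDiffAt ℝ ω Ψ x := hΨ.eventually (by simp)
  have h2 : ∀ᶠ x in 𝓝 x₀, ContDiffAt ℝ ω ψ.symm (ψ x) :=
    (ψ.continuousAt hmem).eventually (hsymm.eventually (by simp))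
  obtain ⟨W, hW, hWo, hxW⟩ := eventually_nhds_iff.1 (h1.and (h2.and hS))
  refine ⟨(ψ.restrOpen W hWo).symm, ?_, ?_, ?_, ?_⟩
  · exact (ψ.restrOpen W hWo).map_source (by simp [hmem, hxW])
  · intro y hy
    have hy' := (ψ.restrOpen W hWo).map_target hy
    have h3 := (hW _ ((ψ.restrOpen_source W hWo ▸ hy').2)).2.1
    have h4 : ψ ((ψ.restrOpen W hWo).symm y) = y := (ψ.restrOpen W hWo).right_inv hy
    rw [h4] at h3
    exact (h3.of_le (by simp)).contDiffWithinAt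
  · intro x hx
    have hx' : x ∈ W := by
      have : x ∈ (ψ.restrOpen W hWo).source := hx
      rw [ψ.restrOpen_source] at this
      exact this.2
    exact ((hW x hx').1.of_le (by simp)).contDiffWithinAt
  · intro y hy
    have hy' := (ψ.restrOpen W hWo).map_target hy
    have h3 := (hW _ ((ψ.restrOpen_source W hWo ▸ hy').2)).2.2
    have h4 : Ψ ((ψ.restrOpen W hWo).symm y) = y := (ψ.restrOpen W hWo).right_inv hy
    rw [h4] at h3
    exact h3

theorem HasDim.le_finrank [FiniteDimensional ℝ E] {S : Set E} {d : ℕ} (h : HasDim S d) :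
    d ≤ Module.finrank ℝ E := by
  obtain ⟨p, hp⟩ := h.1
  obtain ⟨-, F, -, -, -, rfl, -⟩ := h.2 p hp
  exact F.finrank_le

/-- The conditions are the coordinates of the chart modulo `F`, that is, in `E ⧸ F ≃ ℝ^c`. -/
theorem HasCodim.isGivenByConditions [FiniteDimensional ℝ E] {S : Set E} {c : ℕ}
    (h : HasCodim S c) : IsGivenByConditions S c := by
  obtain ⟨d, ⟨-, hd⟩, hdc⟩ := h
  intro p hp
  obtain ⟨φ, F, hpφ, hφ, hφs, hF, hS⟩ := hd p hp
  have hc : Module.finrank ℝ (E ⧸ F) = Module.finrank ℝ (Fin c → ℝ) := by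
    have := F.finrank_quotient_add_finrank
    rw [Module.finrank_fin_fun]
    omega
  let q : E →ₗ[ℝ] (Fin c → ℝ) :=
    (LinearEquiv.ofFinrankEq _ _ hc).toLinearMap ∘ₗ F.mkQ
  have hq0 : ∀ x, q x = 0 ↔ x ∈ F := fun x => by simp [q]
  have hqs : Function.Surjective q :=
    (LinearEquiv.surjective _).comp F.mkQ_surjective
  let Q : E →L[ℝ] (Fin c → ℝ) := LinearMap.toContinuousLinearMap q
  refine ⟨φ.source, fun x => Q (φ x), φ.open_source, hpφ, Q.contDiff.comp_contDiffOn hφ, ?_, ?_⟩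
  · intro x hx
    have hdφ : DifferentiableAt ℝ φ x :=
      (hφ.contDiffAt (φ.open_source.mem_nhds hx)).differentiableAt (by simp)
    have hdφs : DifferentiableAt ℝ φ.symm (φ x) :=
      (hφs.contDiffAt (φ.open_target.mem_nhds (φ.map_source hx))).differentiableAt (by simp)
    have hdφ' : DifferentiableAt ℝ φ (φ.symm (φ x)) := by rwa [φ.left_inv hx]
    -- The chain rule gives the derivative of the chart a right inverse, hence surjectivity.
    have hcomp : (fderiv ℝ φ x).comp (fderiv ℝ φ.symm (φ x)) = ContinuousLinearMap.id ℝ E := by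
      have h1 := fderiv_comp (φ x) hdφ' hdφs
      rw [φ.left_inv hx] at h1
      rw [← h1, ← fderiv_id (𝕜 := ℝ) (x := φ x)]
      apply Filter.EventuallyEq.fderiv_eq
      filter_upwards [φ.open_target.mem_nhds (φ.map_source hx)] with y hy
      exact φ.right_inv hy
    have hf : fderiv ℝ (fun x => Q (φ x)) x = Q.comp (fderiv ℝ φ x) :=
      (Q.hasFDerivAt.comp x hdφ.hasFDerivAt).fderiv
    rw [hf]
    intro y
    obtain ⟨z, rfl⟩ := hqs y
    refine ⟨fderiv ℝ φ.symm (φ x) z, ?_⟩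
    have := DFunLike.congr_fun hcomp z
    simp only [ContinuousLinearMap.comp_apply, ContinuousLinearMap.id_apply] at this ⊢
    rw [this]
    rfl
  · intro x hx
    rw [hS x hx, ← hq0]
    rfl

end Charts

end MultEig

namespace MultEig

/-! ### Multiplicities as level-set sizes, and rigidity of small block perturbations. -/

section Multiplicities

variable {n I : ℕ}

theorem hasMult_diagonal_iff {a : Fin n → ℝ} {k : Fin I → ℕ} :
    HasMult (Matrix.diagonal a) k ↔ ∃ ev : Fin I → ℝ, Function.Injective ev ∧
      Finset.univ.val.map a = ∑ i, k i • ({ev i} : Multiset ℝ) := by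
  have hprod (ev : Fin I → ℝ) : ∏ i, (Polynomial.X - Polynomial.C (ev i)) ^ k i =
      ((∑ i, k i • ({ev i} : Multiset ℝ)).map fun x => Polynomial.X - Polynomial.C x).prod := by
    rw [← Multiset.coe_mapAddMonoidHom, map_sum, Multiset.prod_sum]
    simp [Multiset.map_nsmul, Multiset.prod_nsmul]
  have ha : (Matrix.diagonal a).charpoly =
      ((Finset.univ.val.map a).map fun x => Polynomial.X - Polynomial.C x).prod := by
    rw [Matrix.charpoly_diagonal, Multiset.map_map]
    rfl
  refine exists_congr fun ev => and_congr_right fun _ => ?_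
  rw [hprod, ha]
  refine ⟨fun h => ?_, fun h => by rw [h]⟩
  have := congrArg Polynomial.roots h
  rwa [Polynomial.roots_multiset_prod_X_sub_C, Polynomial.roots_multiset_prod_X_sub_C] at this

theorem mem_range_of_multiset_eq {a : Fin n → ℝ} {k : Fin I → ℕ} (hk : ∀ i, 1 ≤ k i)
    {ev : Fin I → ℝ} (h : Finset.univ.val.map a = ∑ i, k i • ({ev i} : Multiset ℝ)) (x : ℝ) :
    (∃ j, a j = x) ↔ ∃ i, ev i = x := by
  have h1 : x ∈ Finset.univ.val.map a ↔ ∃ j, a j = x := by simp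
  rw [← h1, h, Multiset.mem_sum]
  simp only [Finset.mem_univ, true_and]
  refine exists_congr fun i => ?_
  rw [Multiset.mem_nsmul_of_ne_zero (by have := hk i; omega), Multiset.mem_singleton, eq_comm]

/-- Multiplicities depend only on the partition of the indices into level sets; relabelling the
values by an injection keeps them. -/
theorem HasMult.of_eq_iff_eq {a : Fin n → ℝ} {k : Fin I → ℕ} (hk : ∀ i, 1 ≤ k i)
    (h : HasMult (Matrix.diagonal a) k) {b : Fin n → ℝ} (hb : ∀ i j, a i = a j ↔ b i = b j) :
    HasMult (Matrix.diagonal b) k := by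
  obtain ⟨ev, hev, he⟩ := hasMult_diagonal_iff.1 h
  have hr := mem_range_of_multiset_eq hk he
  let g : ℝ → ℝ := Function.extend a b 0
  have hg : ∀ i, g (a i) = b i := fun i =>
    Function.FactorsThrough.extend_apply (fun i j hij => (hb i j).1 hij) _ i
  refine hasMult_diagonal_iff.2 ⟨g ∘ ev, fun i j hij => ?_, ?_⟩
  · obtain ⟨i', hi⟩ := (hr (ev i)).2 ⟨i, rfl⟩
    obtain ⟨j', hj⟩ := (hr (ev j)).2 ⟨j, rfl⟩
    apply hev
    simp only [Function.comp_apply, ← hi, ← hj, hg] at hij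
    rw [← hi, ← hj, hb, hij]
  · have h1 := congrArg (Multiset.mapAddMonoidHom g) he
    rw [map_sum] at h1
    simp only [Multiset.coe_mapAddMonoidHom, Multiset.map_map, Multiset.map_nsmul,
      Multiset.map_singleton] at h1
    rw [← show g ∘ a = b from funext hg]
    exact h1

theorem HasMult.card_image {a : Fin n → ℝ} {k : Fin I → ℕ} (hk : ∀ i, 1 ≤ k i)
    (h : HasMult (Matrix.diagonal a) k) : (Finset.univ.image a).card = I := by
  obtain ⟨ev, hev, he⟩ := hasMult_diagonal_iff.1 h
  have : Finset.univ.image a = Finset.univ.image ev := by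
    ext x
    simpa using mem_range_of_multiset_eq hk he x
  rw [this, Finset.card_image_of_injective _ hev, Finset.card_fin]

/-- An eigenvalue occurring `k i` times contributes `k i` partners for each occurrence. This is how
the multiplicities enter the dimension count. -/
theorem HasMult.card_filter_eq {a : Fin n → ℝ} {k : Fin I → ℕ}
    (h : HasMult (Matrix.diagonal a) k) :
    (Finset.univ.filter fun p : Fin n × Fin n => a p.1 = a p.2).card = ∑ i, k i ^ 2 := by
  obtain ⟨ev, hev, he⟩ := hasMult_diagonal_iff.1 h
  have hc (x : ℝ) : (Finset.univ.filter fun j => x = a j).card =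
      (Finset.univ.val.map a).count x := by
    rw [Multiset.count_map]
    rfl
  have hce (i : Fin I) : (∑ i, k i • ({ev i} : Multiset ℝ)).count (ev i) = k i := by
    rw [Multiset.count_sum', Finset.sum_eq_single i]
    · simp
    · intro j _ hj
      simp [hev.eq_iff, hj.symm]
    · simp
  rw [Finset.card_filter, Fintype.sum_prod_type]
  simp only [← Finset.card_filter, hc, he]
  have h1 : ∑ j, (∑ i, k i • ({ev i} : Multiset ℝ)).count (a j) =
      ((Finset.univ.val.map a).map
        fun x => (∑ i, k i • ({ev i} : Multiset ℝ)).count x).sum := by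
    rw [Multiset.map_map]
    rfl
  rw [h1, he, ← Multiset.coe_mapAddMonoidHom, map_sum, Multiset.sum_sum]
  refine Finset.sum_congr rfl fun i _ => ?_
  simp only [Multiset.coe_mapAddMonoidHom, Multiset.map_nsmul, Multiset.map_singleton,
    Multiset.sum_nsmul, Multiset.sum_singleton, hce, smul_eq_mul, sq]

theorem exists_hasMult_diagonal {k : Fin I → ℕ} (hk : ∑ i, k i = n) :
    ∃ a : Fin n → ℝ, HasMult (Matrix.diagonal a) k := by
  subst hk
  refine ⟨fun j => ((finSigmaFinEquiv.symm j).1 : ℕ), fun i => (i : ℕ), ?_, ?_⟩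
  · intro i j hij
    exact Fin.ext (Nat.cast_injective hij)
  · rw [Matrix.charpoly_diagonal, ← finSigmaFinEquiv.prod_comp, Fintype.prod_sigma]
    simp

theorem charpoly_orthogonal_conj {O : Matrix (Fin n) (Fin n) ℝ}
    (hO : O ∈ Matrix.orthogonalGroup (Fin n) ℝ) (A : Matrix (Fin n) (Fin n) ℝ) :
    (O * A * O.transpose).charpoly = A.charpoly := by
  rw [Matrix.charpoly_mul_comm, ← mul_assoc]
  have : O.transpose * O = 1 := (Matrix.mem_orthogonalGroup_iff' _ _).1 hO
  rw [this, one_mul]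

theorem exists_orthogonal_diagonalization {A : Matrix (Fin n) (Fin n) ℝ} (hA : A.IsSymm) :
    ∃ U ∈ Matrix.orthogonalGroup (Fin n) ℝ, ∃ d : Fin n → ℝ,
      A = U * Matrix.diagonal d * U.transpose := by
  have hH : A.IsHermitian := by
    rw [Matrix.IsHermitian, Matrix.conjTranspose_eq_transpose_of_trivial]; exact hA
  refine ⟨hH.eigenvectorUnitary, hH.eigenvectorUnitary.2, hH.eigenvalues, ?_⟩
  have := hH.spectral_theorem
  rw [Unitary.conjStarAlgAut_apply] at this
  exact this

/-- The entries of a diagonalizing matrix of a small block perturbation of a diagonal matrix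
link each diagonal entry to nearby eigenvalues only. -/
theorem abs_sub_lt_of_ne_zero {a d : Fin n → ℝ} {B U : Matrix (Fin n) (Fin n) ℝ} {δ ε : ℝ}
    (hBU : B * U = U * Matrix.diagonal d) (hB : ∀ i j, a i ≠ a j → B i j = 0)
    (hε : ∀ i j, |(B - Matrix.diagonal a) i j| ≤ ε) (hδ : n * ε < δ) {i j : Fin n}
    (hU : U i j ≠ 0) : |d j - a i| < δ := by
  -- Gershgorin's argument within one block: take the largest entry of the eigenvector there. `B`
  -- does not couple different blocks, so row `m` of the eigenvalue equation involves this block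
  -- only.
  obtain ⟨m, hm, hmax⟩ := (Finset.univ.filter fun l => a l = a i).exists_max_image
    (fun l => |U l j|) ⟨i, by simp⟩
  simp only [Finset.mem_filter, Finset.mem_univ, true_and] at hm hmax
  have hpos : 0 < |U m j| := (abs_pos.2 hU).trans_le (hmax i rfl)
  have h1 : (d j - a m) * U m j = ∑ l, (B - Matrix.diagonal a) m l * U l j := by
    have h2 := congrFun (congrFun hBU m) j
    rw [Matrix.mul_diagonal] at h2
    rw [← Matrix.mul_apply, Matrix.sub_mul, Matrix.sub_apply, h2, Matrix.diagonal_mul]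
    ring
  have h3 : |d j - a m| * |U m j| ≤ n * ε * |U m j| := by
    rw [← abs_mul, h1]
    refine (Finset.abs_sum_le_sum_abs _ _).trans ?_
    have : ∀ l ∈ (Finset.univ : Finset (Fin n)),
        |(B - Matrix.diagonal a) m l * U l j| ≤ ε * |U m j| := by
      intro l _
      rw [abs_mul]
      by_cases hl : a l = a i
      · exact mul_le_mul (hε m l) (hmax l hl) (abs_nonneg _) ((abs_nonneg _).trans (hε m l))
      · have hml : m ≠ l := fun h => hl (h ▸ hm)
        rw [Matrix.sub_apply, hB m l (by rw [hm]; exact fun h => hl h.symm),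
          Matrix.diagonal_apply_ne _ hml]
        simp only [sub_self, abs_zero, zero_mul]
        exact mul_nonneg ((abs_nonneg _).trans (hε m l)) (abs_nonneg _)
    refine (Finset.sum_le_sum this).trans ?_
    simp [mul_assoc]
  rw [← hm]
  exact (le_of_mul_le_mul_right h3 hpos).trans_lt hδ

theorem eq_diagonal_of_mul_eq {B U : Matrix (Fin n) (Fin n) ℝ} {d b : Fin n → ℝ}
    (hU : U ∈ Matrix.orthogonalGroup (Fin n) ℝ) (hBU : B * U = U * Matrix.diagonal d)
    (h : ∀ i j, U i j ≠ 0 → d j = b i) : B = Matrix.diagonal b := by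
  have hUU : U * U.transpose = 1 := (Matrix.mem_orthogonalGroup_iff _ _).1 hU
  have h1 : B * U = Matrix.diagonal b * U := by
    rw [hBU]
    ext i j
    rw [Matrix.mul_diagonal, Matrix.diagonal_mul]
    by_cases hij : U i j = 0
    · simp [hij]
    · rw [h i j hij, mul_comm]
  calc B = B * U * U.transpose := by rw [mul_assoc, hUU, mul_one]
    _ = _ := by rw [h1, mul_assoc, hUU, mul_one]

theorem exists_ne_zero_row {U : Matrix (Fin n) (Fin n) ℝ}
    (hU : U ∈ Matrix.orthogonalGroup (Fin n) ℝ) (i : Fin n) : ∃ j, U i j ≠ 0 := by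
  by_contra! h
  have hUU : U * U.transpose = 1 := (Matrix.mem_orthogonalGroup_iff _ _).1 hU
  have := congrFun (congrFun hUU i) i
  simp [Matrix.mul_apply, h] at this

theorem exists_ne_zero_col {U : Matrix (Fin n) (Fin n) ℝ}
    (hU : U ∈ Matrix.orthogonalGroup (Fin n) ℝ) (j : Fin n) : ∃ i, U i j ≠ 0 := by
  by_contra! h
  have hUU : U.transpose * U = 1 := (Matrix.mem_orthogonalGroup_iff' _ _).1 hU
  have := congrFun (congrFun hUU j) j
  simp [Matrix.mul_apply, h] at this

section Perturbation

variable {a : Fin n → ℝ} {B : Matrix (Fin n) (Fin n) ℝ} {δ ε : ℝ}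

/-- A small block perturbation of `diagonal a` with as many distinct eigenvalues as `diagonal a`
is scalar on each block. -/
theorem eq_diagonal_of_hasMult {I : ℕ} {k : Fin I → ℕ} (hk : ∀ i, 1 ≤ k i) (hBs : B.IsSymm)
    (ha : HasMult (Matrix.diagonal a) k) (hBk : HasMult B k)
    (hB : ∀ i j, a i ≠ a j → B i j = 0)
    (hε : ∀ i j, |(B - Matrix.diagonal a) i j| ≤ ε) (hδ : n * ε < δ)
    (hsep : ∀ i j, a i ≠ a j → 2 * δ ≤ |a i - a j|) :
    ∃ b : Fin n → ℝ, B = Matrix.diagonal b ∧ ∀ i j, a i = a j → b i = b j := by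
  obtain ⟨U, hU, d, hBd⟩ := exists_orthogonal_diagonalization hBs
  have hUU : U.transpose * U = 1 := (Matrix.mem_orthogonalGroup_iff' _ _).1 hU
  have hBU : B * U = U * Matrix.diagonal d := by rw [hBd, mul_assoc, hUU, mul_one]
  have hclose : ∀ i j, U i j ≠ 0 → |d j - a i| < δ := fun i j =>
    abs_sub_lt_of_ne_zero hBU hB hε hδ
  have hd : HasMult (Matrix.diagonal d) k := by
    rwa [HasMult, hBd, charpoly_orthogonal_conj hU] at hBk
  choose row hrow using exists_ne_zero_row hU
  choose col hcol using exists_ne_zero_col hU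
  have huniq : ∀ i i' j j', U i j ≠ 0 → U i' j' ≠ 0 → d j = d j' → a i = a i' := by
    intro i i' j j' h h' hdd
    by_contra hne
    have h1 := hsep i i' hne
    have h2 := hclose i j h
    have h3 := hclose i' j' h'
    rw [hdd] at h2
    rw [abs_lt] at h2 h3
    have : |a i - a i'| < 2 * δ := by rw [abs_lt]; constructor <;> linarith
    linarith
  -- `g` sends each eigenvalue of `B` to the centre of its cluster; the default `0` is never used.
  let g : ℝ → ℝ := Function.extend d (a ∘ col) 0
  have hg : ∀ i j, U i j ≠ 0 → g (d j) = a i := by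
    intro i j hij
    have : g (d j) = a (col j) := Function.FactorsThrough.extend_apply
      (fun j j' hjj => huniq _ _ _ _ (hcol j) (hcol j') hjj) _ j
    rw [this, huniq _ _ _ _ (hcol j) hij rfl]
  have himg : (Finset.univ.image d).image g = Finset.univ.image a := by
    ext x
    simp only [Finset.mem_image, Finset.mem_univ, true_and, exists_exists_eq_and]
    constructor
    · rintro ⟨j, rfl⟩
      exact ⟨col j, (hg _ _ (hcol j)).symm⟩
    · rintro ⟨i, rfl⟩
      exact ⟨row i, hg _ _ (hrow i)⟩
  -- The decisive count: `g` maps the `I` eigenvalues of `B` onto the `I` values of `a`, so it is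
  -- injective and each cluster holds one eigenvalue.
  have hinj : Set.InjOn g (Finset.univ.image d : Finset ℝ) := by
    apply Finset.card_image_iff.1
    rw [himg, ha.card_image hk, hd.card_image hk]
  have hkey : ∀ i i' j j', U i j ≠ 0 → U i' j' ≠ 0 → a i = a i' → d j = d j' := by
    intro i i' j j' h h' haa
    apply hinj (by simp) (by simp)
    rw [hg i j h, hg i' j' h', haa]
  exact ⟨fun i => d (row i), eq_diagonal_of_mul_eq hU hBU fun i j hij =>
    hkey i i j _ hij (hrow i) rfl, fun i i' h => hkey i i' _ _ (hrow i) (hrow i') h⟩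

/-- A small block perturbation of `diagonal a` with the same eigenvalues is `diagonal a`. -/
theorem eq_diagonal_of_charpoly_eq (hBs : B.IsSymm)
    (hBk : B.charpoly = (Matrix.diagonal a).charpoly)
    (hB : ∀ i j, a i ≠ a j → B i j = 0)
    (hε : ∀ i j, |(B - Matrix.diagonal a) i j| ≤ ε) (hδ : n * ε < δ)
    (hsep : ∀ i j, a i ≠ a j → 2 * δ ≤ |a i - a j|) : B = Matrix.diagonal a := by
  obtain ⟨U, hU, d, hBd⟩ := exists_orthogonal_diagonalization hBs
  have hUU : U.transpose * U = 1 := (Matrix.mem_orthogonalGroup_iff' _ _).1 hU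
  have hBU : B * U = U * Matrix.diagonal d := by rw [hBd, mul_assoc, hUU, mul_one]
  rw [hBd, charpoly_orthogonal_conj hU, Matrix.charpoly_diagonal, Matrix.charpoly_diagonal] at hBk
  refine eq_diagonal_of_mul_eq hU hBU fun i j hij => ?_
  have h1 : |d j - a i| < δ := abs_sub_lt_of_ne_zero hBU hB hε hδ hij
  -- The eigenvalue `d j` is a root of the other characteristic polynomial, so it is some `a i'`;
  -- being within `δ` of `a i`, it equals `a i`.
  have h2 := congrArg (Polynomial.eval (d j)) hBk
  rw [Polynomial.eval_prod, Polynomial.eval_prod, Finset.prod_eq_zero (Finset.mem_univ j) (by simp),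
    eq_comm, Finset.prod_eq_zero_iff] at h2
  obtain ⟨i', -, hi'⟩ := h2
  simp only [Polynomial.eval_sub, Polynomial.eval_X, Polynomial.eval_C, sub_eq_zero] at hi'
  rw [hi'] at h1 ⊢
  by_contra hne
  have h3 := hsep i' i hne
  linarith [abs_nonneg (a i' - a i)]

end Perturbation

end Multiplicities

end MultEig

namespace MultEig

/-! ### The linear models and their dimensions. -/

section Subspaces

variable {n : ℕ}

theorem symMat_apply_comm (S : symMat n) (i j : Fin n) : S.1 i j = S.1 j i :=
  Matrix.IsSymm.apply S.2 j i

/-- The symmetric matrices that vanish on the blocks given by the level sets of `a`. -/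
def offBlock (a : Fin n → ℝ) : Submodule ℝ (symMat n) where
  carrier := {S | ∀ i j, a i = a j → S.1 i j = 0}
  add_mem' hS hT i j h := by simp [hS i j h, hT i j h]
  zero_mem' i j _ := rfl
  smul_mem' c S hS i j h := by simp [hS i j h]

/-- The symmetric matrices that are scalar on the blocks given by the level sets of `a`. -/
def scalarBlock (a : Fin n → ℝ) : Submodule ℝ (symMat n) where
  carrier := {S | (∀ i j, i ≠ j → a i = a j → S.1 i j = 0) ∧
    ∀ i j, a i = a j → S.1 i i = S.1 j j}
  add_mem' hS hT := ⟨fun i j h h' => by simp [hS.1 i j h h', hT.1 i j h h'],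
    fun i j h => by simp [hS.2 i j h, hT.2 i j h]⟩
  zero_mem' := ⟨fun i j _ _ => rfl, fun i j _ => rfl⟩
  smul_mem' c S hS := ⟨fun i j h h' => by simp [hS.1 i j h h'],
    fun i j h => by simp [hS.2 i j h]⟩

/-- The pairs `i < j` in different level sets of `a`. -/
abbrev OffPair (a : Fin n → ℝ) : Type := {p : Fin n × Fin n // p.1 < p.2 ∧ a p.1 ≠ a p.2}

/-- The symmetric matrix with given off-block entries and given scalars on the blocks. -/
noncomputable def blockMatrix (a : Fin n → ℝ) (f : OffPair a → ℝ) (g : Set.range a → ℝ) :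
    symMat n :=
  ⟨Matrix.of fun i j =>
    if i = j then g ⟨a i, i, rfl⟩
    else if h : i < j ∧ a i ≠ a j then f ⟨(i, j), h⟩
    else if h : j < i ∧ a j ≠ a i then f ⟨(j, i), h⟩ else 0, by
    ext i j
    rw [Matrix.transpose_apply, Matrix.of_apply, Matrix.of_apply]
    rcases lt_trichotomy i j with h | rfl | h
    · simp [h, h.ne, h.ne', h.not_gt]
    · rfl
    · simp [h, h.ne, h.ne', h.not_gt]⟩

theorem blockMatrix_diag (a : Fin n → ℝ) (f : OffPair a → ℝ) (g : Set.range a → ℝ) (i : Fin n) :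
    (blockMatrix a f g).1 i i = g ⟨a i, i, rfl⟩ := by
  simp [blockMatrix]

theorem blockMatrix_off (a : Fin n → ℝ) (f : OffPair a → ℝ) (g : Set.range a → ℝ)
    (p : OffPair a) : (blockMatrix a f g).1 p.1.1 p.1.2 = f p := by
  simp [blockMatrix, p.2.1, p.2.1.ne, p.2.2]

theorem blockMatrix_eq_zero {a : Fin n → ℝ} (f : OffPair a → ℝ) (g : Set.range a → ℝ)
    {i j : Fin n} (hij : i ≠ j) (h : a i = a j) : (blockMatrix a f g).1 i j = 0 := by
  simp [blockMatrix, hij, h]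

theorem eq_of_offPair {a : Fin n → ℝ} {S T : symMat n}
    (h0 : ∀ i j, a i = a j → S.1 i j = T.1 i j)
    (h : ∀ p : OffPair a, S.1 p.1.1 p.1.2 = T.1 p.1.1 p.1.2) : S = T := by
  ext i j
  by_cases hij : a i = a j
  · exact h0 i j hij
  · rcases lt_trichotomy i j with hlt | rfl | hlt
    · exact h ⟨(i, j), hlt, hij⟩
    · exact absurd rfl hij
    · rw [symMat_apply_comm S, symMat_apply_comm T]
      exact h ⟨(j, i), hlt, fun h => hij h.symm⟩

theorem finrank_offBlock (a : Fin n → ℝ) :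
    Module.finrank ℝ (offBlock a) = Fintype.card (OffPair a) := by
  let L : offBlock a →ₗ[ℝ] (OffPair a → ℝ) :=
    { toFun := fun S p => S.1.1 p.1.1 p.1.2
      map_add' := fun _ _ => rfl
      map_smul' := fun _ _ => rfl }
  have hL : Function.Bijective L := by
    constructor
    · intro S T hST
      refine Subtype.ext (eq_of_offPair (a := a) (fun i j h => ?_) fun p => congrFun hST p)
      rw [S.2 i j h, T.2 i j h]
    · intro f
      refine ⟨⟨blockMatrix a f 0, fun i j h => ?_⟩, funext fun p => blockMatrix_off a f 0 p⟩
      by_cases hij : i = j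
      · subst hij
        exact blockMatrix_diag a f 0 i
      · exact blockMatrix_eq_zero f 0 hij h
  rw [(LinearEquiv.ofBijective L hL).finrank_eq, Module.finrank_fintype_fun_eq_card]

theorem finrank_scalarBlock (a : Fin n → ℝ) :
    Module.finrank ℝ (scalarBlock a) =
      Fintype.card (OffPair a) + (Finset.univ.image a).card := by
  let L : scalarBlock a →ₗ[ℝ] (OffPair a → ℝ) × (Set.range a → ℝ) :=
    { toFun := fun S => (fun p => S.1.1 p.1.1 p.1.2, fun x => S.1.1 x.2.choose x.2.choose)
      map_add' := fun _ _ => rfl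
      map_smul' := fun _ _ => rfl }
  have hdiag (S : scalarBlock a) (i : Fin n) : S.1.1 i i = (L S).2 ⟨a i, i, rfl⟩ :=
    S.2.2 _ _ (Exists.choose_spec (⟨i, rfl⟩ : ∃ j, a j = a i)).symm
  have hL : Function.Bijective L := by
    constructor
    · intro S T hST
      refine Subtype.ext (eq_of_offPair (a := a) (fun i j h => ?_)
        fun p => congrFun (congrArg Prod.fst hST) p)
      by_cases hij : i = j
      · subst hij
        rw [hdiag, hdiag, hST]
      · rw [S.2.1 i j hij h, T.2.1 i j hij h]
    · rintro ⟨f, g⟩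
      refine ⟨⟨blockMatrix a f g, fun i j h h' => blockMatrix_eq_zero f g h h', fun i j h => ?_⟩,
        Prod.ext (funext fun p => blockMatrix_off a f g p) (funext fun x => ?_)⟩
      · simp only [blockMatrix_diag, h]
      · refine (blockMatrix_diag a f g _).trans (congrArg g (Subtype.ext ?_))
        exact x.2.choose_spec
  rw [(LinearEquiv.ofBijective L hL).finrank_eq, Module.finrank_prod,
    Module.finrank_fintype_fun_eq_card, Module.finrank_fintype_fun_eq_card,
    ← Set.toFinset_card, Set.toFinset_range]

/-- Pairs with different values split into `i < j` and `j < i`, which the swap exchanges. -/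
theorem two_mul_card_offPair_add (a : Fin n → ℝ) :
    2 * Fintype.card (OffPair a) +
      (Finset.univ.filter fun p : Fin n × Fin n => a p.1 = a p.2).card = n ^ 2 := by
  have h1 : Fintype.card (OffPair a) =
      (Finset.univ.filter fun p : Fin n × Fin n => p.1 < p.2 ∧ a p.1 ≠ a p.2).card :=
    Fintype.card_subtype _
  have h2 : (Finset.univ.filter fun p : Fin n × Fin n => p.2 < p.1 ∧ a p.1 ≠ a p.2).card =
      (Finset.univ.filter fun p : Fin n × Fin n => p.1 < p.2 ∧ a p.1 ≠ a p.2).card :=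
    Finset.card_equiv (Equiv.prodComm _ _) (by simp [eq_comm])
  have h3 : (Finset.univ.filter fun p : Fin n × Fin n => a p.1 ≠ a p.2) =
      (Finset.univ.filter fun p : Fin n × Fin n => p.1 < p.2 ∧ a p.1 ≠ a p.2) ∪
      (Finset.univ.filter fun p : Fin n × Fin n => p.2 < p.1 ∧ a p.1 ≠ a p.2) := by
    ext p
    simp only [Finset.mem_filter, Finset.mem_univ, true_and, Finset.mem_union, ← or_and_right]
    refine ⟨fun h => ⟨lt_or_gt_of_ne fun h' => h (congrArg a h'), h⟩, fun h => h.2⟩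
  have h4 := Finset.card_filter_add_card_filter_not (s := Finset.univ)
    (fun p : Fin n × Fin n => a p.1 = a p.2)
  have h5 : (Finset.univ.filter fun p : Fin n × Fin n => a p.1 ≠ a p.2).card =
      2 * Fintype.card (OffPair a) := by
    rw [h3, Finset.card_union_of_disjoint, h2, h1, two_mul]
    rw [Finset.disjoint_filter]
    exact fun p _ h h' => h.1.not_gt h'.1
  simp only [Finset.card_univ, Fintype.card_prod, Fintype.card_fin] at h4
  rw [← h5, sq, ← h4, add_comm]

/-- For injective `a` all blocks have size one and `scalarBlock a` is the whole space, so the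
previous counts apply. -/
theorem two_mul_finrank_symMat (n : ℕ) : 2 * Module.finrank ℝ (symMat n) = n * (n + 1) := by
  let a : Fin n → ℝ := fun i => (i : ℕ)
  have ha : Function.Injective a := fun i j h => Fin.ext (Nat.cast_injective h)
  have h1 : scalarBlock a = ⊤ := by
    refine eq_top_iff.2 fun S _ => ⟨fun i j hij h => absurd (ha h) hij, fun i j h => ?_⟩
    rw [ha h]
  have h2 := finrank_scalarBlock a
  rw [h1, finrank_top, Finset.card_image_of_injective _ ha, Finset.card_fin] at h2
  have h3 := two_mul_card_offPair_add a
  have h4 : (Finset.univ.filter fun p : Fin n × Fin n => a p.1 = a p.2) =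
      Finset.univ.diag := by
    ext p
    simp [ha.eq_iff]
  rw [h4, Finset.diag_card, Finset.card_fin] at h3
  rw [h2]
  nlinarith

end Subspaces

end MultEig

namespace MultEig

/-! ### Smoothness of matrix operations and the Cayley transform. -/

section Smoothness

open Filter Topology

variable {n : ℕ} {X : Type*} [NormedAddCommGroup X] [NormedSpace ℝ X]

/-- Matrix multiplication as a continuous bilinear map. -/
noncomputable def mulCLM (n : ℕ) : Matrix (Fin n) (Fin n) ℝ →L[ℝ] Matrix (Fin n) (Fin n) ℝ →L[ℝ]
    Matrix (Fin n) (Fin n) ℝ :=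
  (LinearMap.mul ℝ (Matrix (Fin n) (Fin n) ℝ)).toContinuousBilinearMap

theorem contDiffAt_matrix_mul {f g : X → Matrix (Fin n) (Fin n) ℝ} {x : X} {m : WithTop ℕ∞}
    (hf : ContDiffAt ℝ m f x) (hg : ContDiffAt ℝ m g x) :
    ContDiffAt ℝ m (fun y => f y * g y) x :=
  (mulCLM n).isBoundedBilinearMap.contDiff.contDiffAt.comp x (hf.prodMk hg)

theorem hasFDerivAt_matrix_mul {f g : X → Matrix (Fin n) (Fin n) ℝ}
    {f' g' : X →L[ℝ] Matrix (Fin n) (Fin n) ℝ} {x : X}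
    (hf : HasFDerivAt f f' x) (hg : HasFDerivAt g g' x) :
    ∃ D : X →L[ℝ] Matrix (Fin n) (Fin n) ℝ, HasFDerivAt (fun y => f y * g y) D x ∧
      ∀ h, D h = f x * g' h + f' h * g x :=
  ⟨_, (mulCLM n).hasFDerivAt_of_bilinear hf hg, fun _ => rfl⟩

theorem contDiffAt_matrix_transpose {f : X → Matrix (Fin n) (Fin n) ℝ} {x : X} {m : WithTop ℕ∞}
    (hf : ContDiffAt ℝ m f x) : ContDiffAt ℝ m (fun y => (f y).transpose) x :=
  (LinearMap.toContinuousLinearMap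
    (Matrix.transposeLinearEquiv (Fin n) (Fin n) ℝ ℝ).toLinearMap).contDiff.contDiffAt.comp x hf

theorem hasFDerivAt_matrix_transpose {f : X → Matrix (Fin n) (Fin n) ℝ}
    {f' : X →L[ℝ] Matrix (Fin n) (Fin n) ℝ} {x : X} (hf : HasFDerivAt f f' x) :
    ∃ D : X →L[ℝ] Matrix (Fin n) (Fin n) ℝ, HasFDerivAt (fun y => (f y).transpose) D x ∧
      ∀ h, D h = (f' h).transpose :=
  ⟨_, (LinearMap.toContinuousLinearMap
    (Matrix.transposeLinearEquiv (Fin n) (Fin n) ℝ ℝ).toLinearMap).hasFDerivAt.comp x hf,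
    fun _ => rfl⟩

theorem contDiff_det {m : WithTop ℕ∞} :
    ContDiff ℝ m (fun A : Matrix (Fin n) (Fin n) ℝ => A.det) := by
  simp only [Matrix.det_apply]
  refine ContDiff.sum fun σ _ => ContDiff.const_smul _ (contDiff_prod fun i _ => ?_)
  exact contDiff_apply_apply ℝ ℝ (σ i) i

theorem contDiff_adjugate {m : WithTop ℕ∞} :
    ContDiff ℝ m (fun A : Matrix (Fin n) (Fin n) ℝ => A.adjugate) := by
  refine contDiff_pi.2 fun i => contDiff_pi.2 fun j => ?_
  simp only [Matrix.adjugate_apply]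
  refine contDiff_det.comp (contDiff_pi.2 fun k => contDiff_pi.2 fun l => ?_)
  by_cases hk : k = j
  · subst hk
    simp only [Matrix.updateRow_self]
    exact contDiff_const
  · simp only [Matrix.updateRow_ne hk]
    exact contDiff_apply_apply ℝ ℝ k l

theorem contDiffAt_matrix_inv {m : WithTop ℕ∞} {A : Matrix (Fin n) (Fin n) ℝ} (hA : A.det ≠ 0) :
    ContDiffAt ℝ m (fun A : Matrix (Fin n) (Fin n) ℝ => A⁻¹) A := by
  simp only [Matrix.inv_def, Ring.inverse_eq_inv']
  exact (contDiff_det.contDiffAt.inv hA).smul contDiff_adjugate.contDiffAt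

/-- The Cayley transform. -/
noncomputable def cayley (K : Matrix (Fin n) (Fin n) ℝ) : Matrix (Fin n) (Fin n) ℝ :=
  (1 + (1 / 2 : ℝ) • K) * (1 - (1 / 2 : ℝ) • K)⁻¹

theorem cayley_zero : cayley (0 : Matrix (Fin n) (Fin n) ℝ) = 1 := by simp [cayley]

/-- Skewness gives `v ⬝ᵥ K v = 0`, so a kernel vector satisfies `v ⬝ᵥ v = 0`. -/
theorem det_one_sub_ne_zero {K : Matrix (Fin n) (Fin n) ℝ} (hK : K.transpose = -K) :
    (1 - (1 / 2 : ℝ) • K).det ≠ 0 := by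
  intro h
  obtain ⟨v, hv, hv0⟩ := Matrix.exists_mulVec_eq_zero_iff.2 h
  have h1 : v ⬝ᵥ K.mulVec v = 0 := by
    have h2 : v ⬝ᵥ K.mulVec v = -(v ⬝ᵥ K.mulVec v) := by
      conv_lhs => rw [Matrix.dotProduct_mulVec, ← Matrix.mulVec_transpose, hK, dotProduct_comm]
      rw [Matrix.neg_mulVec, dotProduct_neg]
    linarith
  rw [Matrix.sub_mulVec, Matrix.one_mulVec, Matrix.smul_mulVec, sub_eq_zero] at hv0
  have h3 : v ⬝ᵥ v = 0 := by
    conv_lhs => rw [hv0]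
    rw [← hv0]
    nth_rw 2 [hv0]
    rw [dotProduct_smul, h1, smul_zero]
  exact hv (dotProduct_self_eq_zero.1 h3)

theorem cayley_mem_orthogonalGroup {K : Matrix (Fin n) (Fin n) ℝ} (hK : K.transpose = -K) :
    cayley K ∈ Matrix.orthogonalGroup (Fin n) ℝ := by
  have h1 := det_one_sub_ne_zero hK
  have hK' : (-K).transpose = -(-K) := by rw [Matrix.transpose_neg, hK]
  have h2 := det_one_sub_ne_zero hK'
  rw [smul_neg, sub_neg_eq_add] at h2
  rw [Matrix.mem_orthogonalGroup_iff]
  have hcomm : Commute (1 + (1 / 2 : ℝ) • K) (1 - (1 / 2 : ℝ) • K) :=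
    ((Commute.one_left _).add_left (((Commute.one_right K).sub_right
      ((Commute.refl K).smul_right _)).smul_left _))
  have ht : (cayley K).transpose = (1 + (1 / 2 : ℝ) • K)⁻¹ * (1 - (1 / 2 : ℝ) • K) := by
    rw [cayley, Matrix.transpose_mul, Matrix.transpose_nonsing_inv]
    simp [hK, sub_eq_add_neg]
  change cayley K * (cayley K).transpose = 1
  rw [ht, cayley]
  set P := 1 + (1 / 2 : ℝ) • K
  set Q := 1 - (1 / 2 : ℝ) • K
  have hP : IsUnit P.det := isUnit_iff_ne_zero.2 h2
  have hQ : IsUnit Q.det := isUnit_iff_ne_zero.2 h1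
  calc P * Q⁻¹ * (P⁻¹ * Q) = P * (Q⁻¹ * P⁻¹) * Q := by simp only [mul_assoc]
    _ = P * (P⁻¹ * Q⁻¹) * Q := by rw [← Matrix.mul_inv_rev, hcomm.eq, Matrix.mul_inv_rev]
    _ = 1 := by
      rw [← mul_assoc P, Matrix.mul_nonsing_inv _ hP, one_mul, Matrix.nonsing_inv_mul _ hQ]

theorem contDiffAt_cayley_zero {m : WithTop ℕ∞} :
    ContDiffAt ℝ m (cayley : Matrix (Fin n) (Fin n) ℝ → _) 0 := by
  have h1 : ContDiff ℝ m fun K : Matrix (Fin n) (Fin n) ℝ => (1 / 2 : ℝ) • K :=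
    contDiff_id.const_smul _
  refine contDiffAt_matrix_mul (contDiff_const.add h1).contDiffAt ?_
  refine ContDiffAt.comp (0 : Matrix (Fin n) (Fin n) ℝ) (contDiffAt_matrix_inv ?_)
    (contDiff_const.sub h1).contDiffAt
  simp

/-- Differentiate `cayley K * (1 - K / 2) = 1 + K / 2` at `0`. The factor `1 / 2` is what makes the
derivative the identity. -/
theorem hasFDerivAt_cayley_zero :
    HasFDerivAt (cayley : Matrix (Fin n) (Fin n) ℝ → _)
      (ContinuousLinearMap.id ℝ (Matrix (Fin n) (Fin n) ℝ)) 0 := by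
  have h0 : HasFDerivAt cayley (fderiv ℝ cayley 0) (0 : Matrix (Fin n) (Fin n) ℝ) :=
    (contDiffAt_cayley_zero.differentiableAt one_ne_zero).hasFDerivAt
  have hh : HasFDerivAt (fun K : Matrix (Fin n) (Fin n) ℝ => (1 / 2 : ℝ) • K)
      ((1 / 2 : ℝ) • ContinuousLinearMap.id ℝ (Matrix (Fin n) (Fin n) ℝ)) 0 :=
    ((1 / 2 : ℝ) • ContinuousLinearMap.id ℝ (Matrix (Fin n) (Fin n) ℝ)).hasFDerivAt
  obtain ⟨D, hD, hDa⟩ := hasFDerivAt_matrix_mul h0 (hh.const_sub 1)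
  have hev : (fun K : Matrix (Fin n) (Fin n) ℝ => cayley K * (1 - (1 / 2 : ℝ) • K)) =ᶠ[𝓝 0]
      fun K => 1 + (1 / 2 : ℝ) • K := by
    have hc : Continuous fun K : Matrix (Fin n) (Fin n) ℝ => (1 - (1 / 2 : ℝ) • K).det := by
      fun_prop
    -- `K` is arbitrary here, not skew, so invertibility comes from continuity of the determinant.
    have : ∀ᶠ K : Matrix (Fin n) (Fin n) ℝ in 𝓝 0, (1 - (1 / 2 : ℝ) • K).det ≠ 0 :=
      hc.continuousAt.eventually_ne (by simp)
    filter_upwards [this] with K hK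
    rw [cayley, mul_assoc, Matrix.nonsing_inv_mul _ (isUnit_iff_ne_zero.2 hK), mul_one]
  have huniq := (hD.congr_of_eventuallyEq hev.symm).unique (hh.const_add 1)
  convert h0 using 1
  ext1 H
  change H = fderiv ℝ cayley 0 H
  have h1 : (1 / 2 : ℝ) • H =
      cayley 0 * -((1 / 2 : ℝ) • H) + fderiv ℝ cayley 0 H * (1 - (1 / 2 : ℝ) • 0) := by
    have h2 := hDa H
    rw [huniq] at h2
    exact h2
  rw [cayley_zero, one_mul, smul_zero, sub_zero, mul_one] at h1
  calc H = (1 / 2 : ℝ) • H + (1 / 2 : ℝ) • H := by module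
    _ = fderiv ℝ cayley 0 H := by nth_rw 2 [h1]; abel

end Smoothness

end MultEig

namespace MultEig

/-! ### The local parametrization and the two sets in its coordinates. -/

section Parametrization

open Filter Topology

variable {n : ℕ}

/-- The symmetric part of a matrix. -/
noncomputable def symPart (n : ℕ) : Matrix (Fin n) (Fin n) ℝ →L[ℝ] symMat n :=
  LinearMap.toContinuousLinearMap
    { toFun := fun A => ⟨(1 / 2 : ℝ) • (A + A.transpose), by
        change ((1 / 2 : ℝ) • (A + A.transpose)).transpose = _
        rw [Matrix.transpose_smul, Matrix.transpose_add, Matrix.transpose_transpose, add_comm]⟩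
      map_add' := fun A B => Subtype.ext (by simp [← smul_add]; abel_nf)
      map_smul' := fun c A => Subtype.ext (by simp [smul_comm c]) }

theorem coe_symPart {A : Matrix (Fin n) (Fin n) ℝ} (hA : A.IsSymm) : (symPart n A).1 = A := by
  change (1 / 2 : ℝ) • (A + A.transpose) = A
  rw [hA.eq, ← two_smul ℝ A, smul_smul]
  norm_num

/-- The skew matrix `K` that solves `K * diagonal a - diagonal a * K = S` off the blocks. -/
noncomputable def skewSolution (a : Fin n → ℝ) : symMat n →L[ℝ] Matrix (Fin n) (Fin n) ℝ :=
  LinearMap.toContinuousLinearMap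
    { toFun := fun S => Matrix.of fun i j => if a i = a j then 0 else S.1 i j / (a j - a i)
      map_add' := fun S T => by ext i j; by_cases h : a i = a j <;> simp [h, add_div]
      map_smul' := fun c S => by ext i j; by_cases h : a i = a j <;> simp [h, mul_div_assoc] }

theorem skewSolution_apply (a : Fin n → ℝ) (S : symMat n) (i j : Fin n) :
    skewSolution a S i j = if a i = a j then 0 else S.1 i j / (a j - a i) := rfl

theorem skewSolution_transpose (a : Fin n → ℝ) (S : symMat n) :
    (skewSolution a S).transpose = -skewSolution a S := by
  ext i j
  rw [Matrix.transpose_apply, Matrix.neg_apply, skewSolution_apply, skewSolution_apply,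
    symMat_apply_comm S j i]
  by_cases h : a i = a j
  · simp [h]
  · rw [if_neg h, if_neg fun h' => h h'.symm, ← div_neg, neg_sub]

/-- The part of a symmetric matrix in the blocks given by the level sets of `a`. -/
noncomputable def blockPart (a : Fin n → ℝ) : symMat n →L[ℝ] Matrix (Fin n) (Fin n) ℝ :=
  LinearMap.toContinuousLinearMap
    { toFun := fun S => Matrix.of fun i j => if a i = a j then S.1 i j else 0
      map_add' := fun S T => by ext i j; by_cases h : a i = a j <;> simp [h]
      map_smul' := fun c S => by ext i j; by_cases h : a i = a j <;> simp [h] }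

theorem blockPart_apply (a : Fin n → ℝ) (S : symMat n) (i j : Fin n) :
    blockPart a S i j = if a i = a j then S.1 i j else 0 := rfl

/-- The orthogonal factor of the parametrization. -/
noncomputable def rotation (a : Fin n → ℝ) (V : Matrix (Fin n) (Fin n) ℝ) (S : symMat n) :
    Matrix (Fin n) (Fin n) ℝ :=
  V * cayley (skewSolution a S)

theorem rotation_zero (a : Fin n → ℝ) (V : Matrix (Fin n) (Fin n) ℝ) : rotation a V 0 = V := by
  rw [rotation, map_zero, cayley_zero, mul_one]

theorem rotation_mem_orthogonalGroup (a : Fin n → ℝ) {V : Matrix (Fin n) (Fin n) ℝ}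
    (hV : V ∈ Matrix.orthogonalGroup (Fin n) ℝ) (S : symMat n) :
    rotation a V S ∈ Matrix.orthogonalGroup (Fin n) ℝ :=
  mul_mem hV (cayley_mem_orthogonalGroup (skewSolution_transpose a S))

/-- The block diagonal factor of the parametrization. -/
noncomputable def blockFactor (a : Fin n → ℝ) (S : symMat n) : Matrix (Fin n) (Fin n) ℝ :=
  Matrix.diagonal a + blockPart a S

theorem blockFactor_isSymm (a : Fin n → ℝ) (S : symMat n) : (blockFactor a S).IsSymm := by
  refine Matrix.IsSymm.add (Matrix.isSymm_diagonal a) ?_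
  ext i j
  rw [Matrix.transpose_apply, blockPart_apply, blockPart_apply, symMat_apply_comm S j i]
  simp only [eq_comm]

/-- The parametrization of the symmetric matrices near `V * diagonal a * Vᵀ`. -/
noncomputable def param (a : Fin n → ℝ) (V : Matrix (Fin n) (Fin n) ℝ) (S : symMat n) : symMat n :=
  symPart n (rotation a V S * blockFactor a S * (rotation a V S).transpose)

/-- The product is already symmetric; `symPart` serves only to land in `symMat n` by a continuous
linear map. -/
theorem coe_param (a : Fin n → ℝ) (V : Matrix (Fin n) (Fin n) ℝ) (S : symMat n) :
    (param a V S).1 = rotation a V S * blockFactor a S * (rotation a V S).transpose := by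
  refine coe_symPart ?_
  change Matrix.transpose _ = _
  rw [Matrix.transpose_mul, Matrix.transpose_mul, Matrix.transpose_transpose,
    (blockFactor_isSymm a S).eq, mul_assoc]

theorem coe_param_zero (a : Fin n → ℝ) (V : Matrix (Fin n) (Fin n) ℝ) :
    (param a V 0).1 = V * Matrix.diagonal a * V.transpose := by
  rw [coe_param, rotation_zero, blockFactor, map_zero, add_zero]

theorem contDiffAt_rotation {m : WithTop ℕ∞} (a : Fin n → ℝ) (V : Matrix (Fin n) (Fin n) ℝ) :
    ContDiffAt ℝ m (rotation a V) 0 := by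
  have h : ContDiffAt ℝ m cayley (skewSolution a 0) := by
    rw [map_zero]
    exact contDiffAt_cayley_zero
  exact contDiffAt_matrix_mul contDiffAt_const
    (h.comp (0 : symMat n) (skewSolution a).contDiff.contDiffAt)

theorem contDiffAt_param {m : WithTop ℕ∞} (a : Fin n → ℝ) (V : Matrix (Fin n) (Fin n) ℝ) :
    ContDiffAt ℝ m (param a V) 0 := by
  refine (symPart n).contDiff.contDiffAt.comp (0 : symMat n) ?_
  refine contDiffAt_matrix_mul (contDiffAt_matrix_mul (contDiffAt_rotation a V) ?_)
    (contDiffAt_matrix_transpose (contDiffAt_rotation a V))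
  exact (contDiff_const.add (blockPart a).contDiff).contDiffAt

theorem hasFDerivAt_rotation (a : Fin n → ℝ) (V : Matrix (Fin n) (Fin n) ℝ) :
    ∃ D : symMat n →L[ℝ] Matrix (Fin n) (Fin n) ℝ, HasFDerivAt (rotation a V) D 0 ∧
      ∀ S, D S = V * skewSolution a S := by
  have hc : HasFDerivAt (fun S => cayley (skewSolution a S)) (skewSolution a) 0 := by
    have h := hasFDerivAt_cayley_zero (n := n)
    rw [← map_zero (skewSolution a)] at h
    exact h.comp (0 : symMat n) (skewSolution a).hasFDerivAt
  obtain ⟨D, hD, hDa⟩ := hasFDerivAt_matrix_mul (hasFDerivAt_const V (0 : symMat n)) hc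
  refine ⟨D, hD, fun S => (hDa S).trans ?_⟩
  change V * skewSolution a S + 0 * _ = _
  rw [zero_mul, add_zero]

/-- The commutator has entries `K i j * (a j - a i)`: it recovers `S` off the blocks and vanishes on
them. -/
theorem commutator_add_blockPart (a : Fin n → ℝ) (S : symMat n) :
    skewSolution a S * Matrix.diagonal a - Matrix.diagonal a * skewSolution a S +
      blockPart a S = S.1 := by
  ext i j
  rw [Matrix.add_apply, Matrix.sub_apply, Matrix.mul_diagonal, Matrix.diagonal_mul,
    skewSolution_apply, blockPart_apply]
  by_cases h : a i = a j
  · simp [h]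
  · have : a j - a i ≠ 0 := sub_ne_zero.2 fun h' => h h'.symm
    simp only [h, if_false]
    field_simp
    ring

/-- Conjugation of symmetric matrices by an orthogonal matrix. -/
noncomputable def conjEquiv {V : Matrix (Fin n) (Fin n) ℝ}
    (hV : V ∈ Matrix.orthogonalGroup (Fin n) ℝ) : symMat n ≃L[ℝ] symMat n :=
  LinearEquiv.toContinuousLinearEquiv <| LinearEquiv.ofInjectiveEndo
    { toFun := fun S => symPart n (V * S.1 * V.transpose)
      map_add' := fun S T => by
        rw [← map_add, ← add_mul, ← mul_add]
        rfl
      map_smul' := fun c S => by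
        rw [RingHom.id_apply, ← map_smul, ← Matrix.smul_mul, ← Matrix.mul_smul]
        rfl } <| by
    intro S T h
    have hVV : V.transpose * V = 1 := (Matrix.mem_orthogonalGroup_iff' _ _).1 hV
    have hs (R : symMat n) : (symPart n (V * R.1 * V.transpose)).1 = V * R.1 * V.transpose := by
      refine coe_symPart ?_
      change Matrix.transpose _ = _
      rw [Matrix.transpose_mul, Matrix.transpose_mul, Matrix.transpose_transpose,
        show R.1.transpose = R.1 from R.2, mul_assoc]
    have h1 : V * S.1 * V.transpose = V * T.1 * V.transpose := by
      rw [← hs S, ← hs T]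
      exact congrArg Subtype.val h
    have h2 (R : symMat n) : V.transpose * (V * R.1 * V.transpose) * V = R.1 := by
      rw [← mul_assoc, ← mul_assoc, hVV, one_mul, mul_assoc, hVV, mul_one]
    exact Subtype.ext (by rw [← h2 S, h1, h2 T])

/-- Since `K` is skew, the product rule yields `V * (K * Λ - Λ * K + blockPart a S) * Vᵀ` with `Λ =
diagonal a`, and the bracket is `S`. -/
theorem hasFDerivAt_param (a : Fin n → ℝ) {V : Matrix (Fin n) (Fin n) ℝ}
    (hV : V ∈ Matrix.orthogonalGroup (Fin n) ℝ) :
    HasFDerivAt (param a V) (conjEquiv hV : symMat n →L[ℝ] symMat n) 0 := by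
  obtain ⟨D₁, h₁, hD₁⟩ := hasFDerivAt_rotation a V
  have hb : HasFDerivAt (blockFactor a) (blockPart a) 0 :=
    (blockPart a).hasFDerivAt.const_add (Matrix.diagonal a)
  obtain ⟨D₂, h₂, hD₂⟩ := hasFDerivAt_matrix_mul h₁ hb
  obtain ⟨D₃, h₃, hD₃⟩ := hasFDerivAt_matrix_transpose h₁
  obtain ⟨D₄, h₄, hD₄⟩ := hasFDerivAt_matrix_mul h₂ h₃
  refine ((symPart n).hasFDerivAt.comp (0 : symMat n) h₄).congr_fderiv
    (ContinuousLinearMap.ext fun S => ?_)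
  refine (congrArg (symPart n) ?_ : symPart n (D₄ S) = symPart n (V * S.1 * V.transpose))
  have e₂ := (hD₂ S).trans
    (congrArg (fun Z => rotation a V 0 * blockPart a S + Z * blockFactor a 0) (hD₁ S))
  have e₃ := (hD₃ S).trans (congrArg Matrix.transpose (hD₁ S))
  refine (hD₄ S).trans ((congrArg₂ (fun Y Z => rotation a V 0 * blockFactor a 0 * Y +
    Z * (rotation a V 0).transpose) e₃ e₂).trans ?_)
  simp only [Matrix.transpose_mul, skewSolution_transpose, rotation_zero, blockFactor, map_zero,
    add_zero]
  rw [← commutator_add_blockPart a S]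
  noncomm_ring

theorem charpoly_param (a : Fin n → ℝ) {V : Matrix (Fin n) (Fin n) ℝ}
    (hV : V ∈ Matrix.orthogonalGroup (Fin n) ℝ) (S : symMat n) :
    (param a V S).1.charpoly = (blockFactor a S).charpoly := by
  rw [coe_param, charpoly_orthogonal_conj (rotation_mem_orthogonalGroup a hV S)]

theorem blockFactor_eq_zero {a : Fin n → ℝ} (S : symMat n) {i j : Fin n} (h : a i ≠ a j) :
    blockFactor a S i j = 0 := by
  rw [blockFactor, Matrix.add_apply, blockPart_apply, if_neg h,
    Matrix.diagonal_apply_ne _ fun h' => h (congrArg a h'), add_zero]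

theorem blockFactor_of_eq {a : Fin n → ℝ} (S : symMat n) {i j : Fin n} (h : a i = a j) :
    S.1 i j = blockFactor a S i j - Matrix.diagonal a i j := by
  rw [blockFactor, Matrix.add_apply, blockPart_apply, if_pos h, add_sub_cancel_left]

theorem exists_separation (a : Fin n → ℝ) :
    ∃ δ > 0, ∀ i j, a i ≠ a j → 2 * δ ≤ |a i - a j| := by
  have h : ∀ p : Fin n × Fin n, ∃ δ > 0, a p.1 ≠ a p.2 → 2 * δ ≤ |a p.1 - a p.2| := by
    intro p
    by_cases hp : a p.1 = a p.2
    · exact ⟨1, one_pos, fun h => absurd hp h⟩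
    · exact ⟨|a p.1 - a p.2| / 2, half_pos (abs_pos.2 (sub_ne_zero.2 hp)), fun _ => by linarith⟩
  choose d hd hda using h
  by_cases hne : Nonempty (Fin n × Fin n)
  · obtain ⟨p, hp⟩ := Finite.exists_min d
    exact ⟨d p, hd p, fun i j hij => by linarith [hda (i, j) hij, hp (i, j)]⟩
  · exact ⟨1, one_pos, fun i j => absurd ⟨(i, j)⟩ hne⟩

theorem eventually_abs_le (n : ℕ) {ε : ℝ} (hε : 0 < ε) :
    ∀ᶠ S : symMat n in 𝓝 0, ∀ i j, |S.1 i j| ≤ ε := by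
  filter_upwards [Metric.ball_mem_nhds (0 : symMat n) hε] with S hS i j
  rw [mem_ball_zero_iff] at hS
  exact (Matrix.norm_entry_le_entrywise_sup_norm S.1).trans hS.le

theorem abs_blockFactor_sub_le {a : Fin n → ℝ} {S : symMat n} {ε : ℝ}
    (hS : ∀ i j, |S.1 i j| ≤ ε) (i j : Fin n) :
    |(blockFactor a S - Matrix.diagonal a) i j| ≤ ε := by
  rw [blockFactor, add_sub_cancel_left, blockPart_apply]
  split_ifs
  · exact hS i j
  · rw [abs_zero]
    exact (abs_nonneg _).trans (hS i j)

theorem param_mem_orthOrbit_iff (a : Fin n → ℝ) {V : Matrix (Fin n) (Fin n) ℝ}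
    (hV : V ∈ Matrix.orthogonalGroup (Fin n) ℝ) :
    ∀ᶠ S in 𝓝 0, (param a V S ∈ orthOrbit a ↔ S ∈ offBlock a) := by
  obtain ⟨δ, hδ, hsep⟩ := exists_separation a
  have hn : (0 : ℝ) < n + 1 := by positivity
  -- Dividing by `n + 1` keeps the bound strict and allows `n = 0`.
  have hnε : (n : ℝ) * (δ / (n + 1)) < δ := by
    rw [mul_div_assoc', div_lt_iff₀ hn]
    linarith
  filter_upwards [eventually_abs_le n (div_pos hδ hn)] with S hS
  constructor
  · rintro ⟨O, hO, h⟩ i j hij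
    have hc : (blockFactor a S).charpoly = (Matrix.diagonal a).charpoly := by
      rw [← charpoly_param a hV, h, charpoly_orthogonal_conj hO]
    rw [blockFactor_of_eq S hij, eq_diagonal_of_charpoly_eq (blockFactor_isSymm a S) hc
      (fun _ _ h => blockFactor_eq_zero S h) (abs_blockFactor_sub_le hS) hnε hsep, sub_self]
  · intro h
    have hB : blockFactor a S = Matrix.diagonal a := by
      ext i j
      by_cases hij : a i = a j
      · have h1 := blockFactor_of_eq S hij
        rw [h i j hij] at h1
        linarith
      · rw [blockFactor_eq_zero S hij, Matrix.diagonal_apply_ne _ fun h' => hij (congrArg a h')]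
    exact ⟨_, rotation_mem_orthogonalGroup a hV S, by rw [coe_param, hB]⟩

theorem param_mem_multSet_iff {I : ℕ} {k : Fin I → ℕ} (hk : ∀ i, 1 ≤ k i) {a : Fin n → ℝ}
    (ha : HasMult (Matrix.diagonal a) k) {V : Matrix (Fin n) (Fin n) ℝ}
    (hV : V ∈ Matrix.orthogonalGroup (Fin n) ℝ) :
    ∀ᶠ S in 𝓝 0, (param a V S ∈ multSet n k ↔ S ∈ scalarBlock a) := by
  obtain ⟨δ, hδ, hsep⟩ := exists_separation a
  have hn : (0 : ℝ) < n + 1 := by positivity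
  have hnε : (n : ℝ) * (δ / (n + 1)) < δ := by
    rw [mul_div_assoc', div_lt_iff₀ hn]
    linarith
  -- The bound `δ / 2` serves the converse: two diagonal entries then approach each other by at most
  -- `δ`, so values at least `2 * δ` apart stay distinct.
  filter_upwards [eventually_abs_le n (div_pos hδ hn), eventually_abs_le n (half_pos hδ)]
    with S hS hS'
  have hmem : param a V S ∈ multSet n k ↔ HasMult (blockFactor a S) k := by
    change HasMult _ k ↔ _
    rw [HasMult, charpoly_param a hV, HasMult]
  rw [hmem]
  constructor
  · intro h
    obtain ⟨b, hb, hab⟩ := eq_diagonal_of_hasMult hk (blockFactor_isSymm a S) ha h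
      (fun _ _ h => blockFactor_eq_zero S h) (abs_blockFactor_sub_le hS) hnε hsep
    refine ⟨fun i j hij h' => ?_, fun i j h' => ?_⟩
    · rw [blockFactor_of_eq S h', hb, Matrix.diagonal_apply_ne _ hij,
        Matrix.diagonal_apply_ne _ hij, sub_self]
    · rw [blockFactor_of_eq S (i := i) rfl, blockFactor_of_eq S (i := j) rfl, hb]
      simp only [Matrix.diagonal_apply_eq]
      rw [hab i j h', h']
  · intro h
    have hB : blockFactor a S = Matrix.diagonal fun i => a i + S.1 i i := by
      ext i j
      by_cases hij : i = j
      · subst hij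
        rw [Matrix.diagonal_apply_eq, blockFactor_of_eq S (i := i) rfl, Matrix.diagonal_apply_eq]
        ring
      · rw [Matrix.diagonal_apply_ne _ hij]
        by_cases ha' : a i = a j
        · have h1 := blockFactor_of_eq S ha'
          rw [h.1 i j hij ha', Matrix.diagonal_apply_ne _ hij] at h1
          linarith
        · exact blockFactor_eq_zero S ha'
    rw [hB]
    refine ha.of_eq_iff_eq hk fun i j => ⟨fun hij => by rw [hij, h.2 i j hij], fun hij => ?_⟩
    by_contra hne
    have h1 := hsep i j hne
    have h2 := abs_le.1 (hS' i i)
    have h3 := abs_le.1 (hS' j j)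
    have : |a i - a j| ≤ δ := by rw [abs_le]; constructor <;> linarith
    linarith

theorem hasDim_orthOrbit (a : Fin n → ℝ) :
    HasDim (orthOrbit a) (Module.finrank ℝ (offBlock a)) := by
  refine ⟨⟨param a 1 0, 1, one_mem _, coe_param_zero a 1⟩, ?_⟩
  rintro p ⟨V, hV, hp⟩
  have hp' : param a V 0 = p := Subtype.ext (by rw [coe_param_zero, hp])
  obtain ⟨φ, h1, h2, h3, h4⟩ := exists_chart_of_param (contDiffAt_param a V)
    (hasFDerivAt_param a hV) (param_mem_orthOrbit_iff a hV)
  exact ⟨φ, _, hp' ▸ h1, h2, h3, rfl, h4⟩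

/-- Different points diagonalize to different `a`, so the model subspace varies; `hd` asks that its
dimension does not. -/
theorem hasDim_multSet {I : ℕ} {k : Fin I → ℕ} (hk : ∀ i, 1 ≤ k i) (hkn : ∑ i, k i = n) {d : ℕ}
    (hd : ∀ a : Fin n → ℝ, HasMult (Matrix.diagonal a) k →
      Module.finrank ℝ (scalarBlock a) = d) :
    HasDim (multSet n k) d := by
  constructor
  · obtain ⟨a, ha⟩ := exists_hasMult_diagonal hkn
    exact ⟨⟨Matrix.diagonal a, Matrix.isSymm_diagonal a⟩, ha⟩
  · intro p hpk
    obtain ⟨V, hV, a, hp⟩ := exists_orthogonal_diagonalization p.2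
    have ha : HasMult (Matrix.diagonal a) k := by
      have : HasMult p.1 k := hpk
      rwa [HasMult, hp, charpoly_orthogonal_conj hV] at this
    have hp' : param a V 0 = p := Subtype.ext (by rw [coe_param_zero, hp])
    obtain ⟨φ, h1, h2, h3, h4⟩ := exists_chart_of_param (contDiffAt_param a V)
      (hasFDerivAt_param a hV) (param_mem_multSet_iff hk ha hV)
    exact ⟨φ, _, hp' ▸ h1, h2, h3, hd a ha, h4⟩

end Parametrization

end MultEig

namespace MultEig

/-! ### Arithmetic of dimensions and codimensions, in `ℚ` to avoid truncated subtraction. -/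

section Dimensions

variable {n I : ℕ} {k : Fin I → ℕ}

theorem finrank_symMat (n : ℕ) : (Module.finrank ℝ (symMat n) : ℚ) = n * (n + 1) / 2 := by
  have h : (2 : ℚ) * Module.finrank ℝ (symMat n) = n * (n + 1) := by
    exact_mod_cast two_mul_finrank_symMat n
  linarith

theorem card_offPair (hkn : ∑ i, k i = n) {a : Fin n → ℝ} (ha : HasMult (Matrix.diagonal a) k) :
    (Fintype.card (OffPair a) : ℚ) = n * (n - 1) / 2 - ∑ i, (k i : ℚ) * (k i - 1) / 2 := by
  have h1 := two_mul_card_offPair_add a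
  rw [ha.card_filter_eq] at h1
  have h2 : (2 : ℚ) * Fintype.card (OffPair a) + ∑ i, (k i : ℚ) ^ 2 = n ^ 2 := by exact_mod_cast h1
  have h3 : ∑ i, (k i : ℚ) = n := by exact_mod_cast hkn
  have h4 : ∑ i, (k i : ℚ) * (k i - 1) / 2 = (∑ i, (k i : ℚ) ^ 2 - ∑ i, (k i : ℚ)) / 2 := by
    rw [← Finset.sum_sub_distrib, Finset.sum_div]
    exact Finset.sum_congr rfl fun i _ => by ring
  rw [h4, h3]
  linarith

theorem exists_hasDim_multSet (hk : ∀ i, 1 ≤ k i) (hkn : ∑ i, k i = n) :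
    ∃ d : ℕ, HasDim (multSet n k) d ∧
      (d : ℚ) = n * (n - 1) / 2 + I - ∑ i, (k i : ℚ) * (k i - 1) / 2 := by
  have hdim (a : Fin n → ℝ) (ha : HasMult (Matrix.diagonal a) k) :
      (Module.finrank ℝ (scalarBlock a) : ℚ) =
        n * (n - 1) / 2 + I - ∑ i, (k i : ℚ) * (k i - 1) / 2 := by
    rw [finrank_scalarBlock, Nat.cast_add, card_offPair hkn ha, ha.card_image hk]
    ring
  obtain ⟨a, ha⟩ := exists_hasMult_diagonal hkn
  refine ⟨Module.finrank ℝ (scalarBlock a), hasDim_multSet hk hkn fun b hb => ?_, hdim a ha⟩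
  have := (hdim b hb).trans (hdim a ha).symm
  exact_mod_cast this

theorem exists_hasCodim_multSet (hk : ∀ i, 1 ≤ k i) (hkn : ∑ i, k i = n) :
    ∃ c : ℕ, HasCodim (multSet n k) c ∧
      (c : ℚ) = n * (n + 1) / 2 - (n * (n - 1) / 2 + I - ∑ i, (k i : ℚ) * (k i - 1) / 2) ∧
      (c : ℚ) = 1 / 2 * ∑ i, ((k i : ℚ) + 2) * (k i - 1) := by
  obtain ⟨d, hd, hdn⟩ := exists_hasDim_multSet hk hkn
  obtain ⟨c, hc⟩ := Nat.exists_eq_add_of_le hd.le_finrank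
  have h1 : (d : ℚ) + c = n * (n + 1) / 2 := by
    rw [← finrank_symMat, hc]
    push_cast
    rfl
  have h2 : (c : ℚ) =
      n * (n + 1) / 2 - (n * (n - 1) / 2 + I - ∑ i, (k i : ℚ) * (k i - 1) / 2) := by linarith
  refine ⟨c, ⟨d, hd, hc.symm⟩, h2, ?_⟩
  have h3 : ∑ i, (k i : ℚ) = n := by exact_mod_cast hkn
  have h4 : 1 / 2 * ∑ i, ((k i : ℚ) + 2) * (k i - 1) =
      ∑ i, (k i : ℚ) * (k i - 1) / 2 + ∑ i, (k i : ℚ) - ∑ _i : Fin I, (1 : ℚ) := by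
    rw [← Finset.sum_add_distrib, ← Finset.sum_sub_distrib, Finset.mul_sum]
    exact Finset.sum_congr rfl fun i _ => by ring
  rw [h2, h4, h3, Finset.sum_const, Finset.card_univ, Fintype.card_fin, nsmul_eq_mul]
  ring

theorem exists_hasCodim_multSet_cons {k : ℕ} (hk : 1 ≤ k) (hkn : k ≤ n) :
    ∃ c : ℕ, HasCodim (multSet n (Fin.cons k (fun _ => 1) : Fin (n - k + 1) → ℕ)) c ∧
      (c : ℚ) = ((k : ℚ) + 2) * (k - 1) / 2 := by
  obtain ⟨c, hc, -, h⟩ := exists_hasCodim_multSet (n := n)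
    (k := (Fin.cons k (fun _ => 1) : Fin (n - k + 1) → ℕ))
    (by
      intro i
      refine Fin.cases hk (fun j => ?_) i
      rw [Fin.cons_succ])
    (by
      rw [Fin.sum_univ_succ]
      simp only [Fin.cons_zero, Fin.cons_succ, Finset.sum_const, Finset.card_univ,
        Fintype.card_fin, smul_eq_mul, mul_one]
      omega)
  refine ⟨c, hc, ?_⟩
  rw [h, Fin.sum_univ_succ]
  simp only [Fin.cons_zero, Fin.cons_succ]
  norm_num
  ring

/-- The other multiplicities add nonnegative terms, whose sum is zero only if every factor `l i - 1`
is. -/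
theorem exists_hasCodim_multSet_ge {J : ℕ} {l : Fin (J + 1) → ℕ} (hl : ∀ i, 1 ≤ l i)
    (hln : ∑ i, l i = n) :
    ∃ c : ℕ, HasCodim (multSet n l) c ∧ ((l 0 : ℚ) + 2) * (l 0 - 1) / 2 ≤ c ∧
      ((c : ℚ) = ((l 0 : ℚ) + 2) * (l 0 - 1) / 2 ↔ ∀ i, i ≠ 0 → l i = 1) := by
  obtain ⟨c, hc, -, h⟩ := exists_hasCodim_multSet hl hln
  have hl' (i : Fin (J + 1)) : (1 : ℚ) ≤ l i := by exact_mod_cast hl i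
  have hnn (i : Fin J) : 0 ≤ ((l i.succ : ℚ) + 2) * (l i.succ - 1) :=
    mul_nonneg (by linarith [hl' i.succ]) (by linarith [hl' i.succ])
  have hs : 0 ≤ ∑ i : Fin J, ((l i.succ : ℚ) + 2) * (l i.succ - 1) :=
    Finset.sum_nonneg fun i _ => hnn i
  rw [Fin.sum_univ_succ] at h
  refine ⟨c, hc, by linarith, ?_⟩
  have h0 : (c : ℚ) = ((l 0 : ℚ) + 2) * (l 0 - 1) / 2 ↔
      ∑ i : Fin J, ((l i.succ : ℚ) + 2) * (l i.succ - 1) = 0 := by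
    constructor <;> intro <;> linarith
  rw [h0, Finset.sum_eq_zero_iff_of_nonneg fun i _ => hnn i]
  constructor
  · intro hz i hi
    obtain ⟨j, rfl⟩ := Fin.exists_succ_eq.2 hi
    rcases mul_eq_zero.1 (hz j (Finset.mem_univ j)) with hj | hj
    · linarith [hl' j.succ]
    · exact_mod_cast sub_eq_zero.1 hj
  · intro hz i _
    rw [hz i.succ (Fin.succ_ne_zero i)]
    norm_num

end Dimensions

end MultEig

theorem corollary5p2 (n : ℕ) :
    (Module.finrank ℝ (MultEig.symMat n) : ℚ) = n * (n + 1) / 2 ∧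
    (∀ (I : ℕ) (k : Fin I → ℕ), (∀ i, 1 ≤ k i) → ∑ i, k i = n →
      (∀ a : Fin n → ℝ, MultEig.HasMult (Matrix.diagonal a) k →
        ∃ d : ℕ, MultEig.HasDim (MultEig.orthOrbit a) d ∧
          (d : ℚ) = n * (n - 1) / 2 - ∑ i, (k i : ℚ) * (k i - 1) / 2) ∧
      (∃ d : ℕ, MultEig.HasDim (MultEig.multSet n k) d ∧
        (d : ℚ) = n * (n - 1) / 2 + I - ∑ i, (k i : ℚ) * (k i - 1) / 2) ∧
      (∃ c : ℕ, MultEig.HasCodim (MultEig.multSet n k) c ∧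
        MultEig.IsGivenByConditions (MultEig.multSet n k) c ∧
        (c : ℚ) = n * (n + 1) / 2
          - (n * (n - 1) / 2 + I - ∑ i, (k i : ℚ) * (k i - 1) / 2) ∧
        (c : ℚ) = 1 / 2 * ∑ i, ((k i : ℚ) + 2) * (k i - 1))) ∧
    (∀ k : ℕ, 1 ≤ k → k ≤ n →
      (∃ c : ℕ,
        MultEig.HasCodim
          (MultEig.multSet n (Fin.cons k (fun _ => 1) : Fin (n - k + 1) → ℕ)) c ∧
        MultEig.IsGivenByConditions
          (MultEig.multSet n (Fin.cons k (fun _ => 1) : Fin (n - k + 1) → ℕ)) c ∧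
        (c : ℚ) = ((k : ℚ) + 2) * (k - 1) / 2) ∧
      (∀ (J : ℕ) (l : Fin (J + 1) → ℕ), (∀ i, 1 ≤ l i) → ∑ i, l i = n → l 0 = k →
        ∃ c : ℕ, MultEig.HasCodim (MultEig.multSet n l) c ∧
          ((k : ℚ) + 2) * (k - 1) / 2 ≤ c ∧
          ((c : ℚ) = ((k : ℚ) + 2) * (k - 1) / 2 ↔ ∀ i, i ≠ 0 → l i = 1))) ∧
    (2 ≤ n →
      MultEig.HasCodim
        (MultEig.multSet n (Fin.cons 2 (fun _ => 1) : Fin (n - 2 + 1) → ℕ)) 2 ∧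
      MultEig.IsGivenByConditions
        (MultEig.multSet n (Fin.cons 2 (fun _ => 1) : Fin (n - 2 + 1) → ℕ)) 2) := by
  refine ⟨MultEig.finrank_symMat n, fun I k hk hkn => ⟨fun a ha => ?_,
    MultEig.exists_hasDim_multSet hk hkn, ?_⟩, fun k hk hkn => ⟨?_, ?_⟩, fun hn => ?_⟩
  · exact ⟨_, MultEig.hasDim_orthOrbit a, by
      rw [MultEig.finrank_offBlock, MultEig.card_offPair hkn ha]⟩
  · obtain ⟨c, hc, h1, h2⟩ := MultEig.exists_hasCodim_multSet hk hkn
    exact ⟨c, hc, hc.isGivenByConditions, h1, h2⟩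
  · obtain ⟨c, hc, h⟩ := MultEig.exists_hasCodim_multSet_cons hk hkn
    exact ⟨c, hc, hc.isGivenByConditions, h⟩
  · rintro J l hl hln rfl
    exact MultEig.exists_hasCodim_multSet_ge hl hln
  · obtain ⟨c, hc, h⟩ := MultEig.exists_hasCodim_multSet_cons one_le_two hn
    have hc2 : c = 2 := by
      norm_num at h
      exact_mod_cast h
    subst hc2
    exact ⟨hc, hc.isGivenByConditions⟩
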